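/- Let $G$ be a compact Lie group acting smoothly on a closed manifold $N$ (smooth, compact, Hausdorff, without boundary). For $u\in N$ let $G_u$ denote the isotropy group of $u$, write $[u]\le[v]$ if some conjugate of $G_v$ is contained in $G_u$, and for a subgroup $K\subset G$ let $N_{(K)}$ be the set of points of $N$ whose isotropy group is conjugate to $K$. Let $\mathcal Z_u$ be the $G$-orbit of the connected component of $N_{(G_u)}$ containing $u$; the sets $\mathcal Z_u$, $u\in N$, are the strata of the $\mathcal Z$-stratification of $N$. A stratum $\mathcal Z_u$ is called locally minimal if there is an open $G$-invariant set $U\supset\overline{\mathcal Z_u}$ such that $[u]\le[v]$ for all $v\in U$, and $\alpha_G(N)$ denotes the number of locally minimal strata. A $G$-invariant set $U\subset N$ is called $G$-categorical if there are a continuous $G$-equivariant map $\mathcal H\colon U\times[0,1]\to N$ such that $\mathcal H_0$ is the inclusion, and a point $w\in N$, such that $\mathcal H_1(U)$ is contained in the orbit of $w$. The $G$-equivariant LS category $\mathrm{cat}_G(N)$ is the least number of open $G$-categorical sets required to cover $N$ (and $\infty$ if there is no finite cover of this kind). Then $$\mathrm{cat}_G(N)\ \ge\ \alpha_G(N),$$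 and a stratum $\mathcal Z_u$ is locally minimal if and only if it is a closed subset of $N$. -/

import Mathlib

open scoped Manifold ContDiff

namespace EquivariantLS

variable (G : Type*) [Group G] {N : Type*} [TopologicalSpace N] [MulAction G N]

/-- A subset of a `G`-space is invariant if every element of `G` maps it into itself. -/
def IsInvariant (U : Set N) : Prop :=
  ∀ g : G, ∀ u ∈ U, g • u ∈ U

/-- A `G`-homotopy on an invariant subset `U`: a continuous, `G`-equivariant map
`H : U × [0,1] → N` such that `H₀` is the inclusion of `U`. -/
structure IsGHomotopy (U : Set N) (H : U × unitInterval → N) : Prop where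
  continuous : Continuous H
  equivariant : ∀ (g : G) (x y : U) (t : unitInterval),
    (y : N) = g • (x : N) → H (y, t) = g • H (x, t)
  initial : ∀ x : U, H (x, 0) = x

/-- An invariant subset `U` is `G`-categorical if some `G`-homotopy on `U` ends with a map whose
image lies in a single orbit. -/
def IsGCategorical (U : Set N) : Prop :=
  IsInvariant G U ∧
    ∃ H : U × unitInterval → N, IsGHomotopy G U H ∧
      ∃ w : N, ∀ x : U, H (x, 1) ∈ MulAction.orbit G w

variable (N) in
/-- The `G`-category of `N`: the least number of `G`-categorical open sets required to cover `N`
(`⊤` if there is no finite cover by such sets). -/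
noncomputable def gCat : ℕ∞ :=
  sInf {n : ℕ∞ | ∃ C : Set (Set N),
    (∀ U ∈ C, IsOpen U ∧ IsGCategorical G U) ∧ ⋃₀ C = Set.univ ∧ C.encard = n}

/-- The order on orbit types: `[u] ≤ [v]` if a conjugate of the isotropy group of `v` is contained
in the isotropy group of `u`. -/
def OrbitTypeLE {N : Type*} [MulAction G N] (u v : N) : Prop :=
  ∃ a : G, (MulAction.stabilizer G v).map (MulAut.conj a).toMonoidHom ≤ MulAction.stabilizer G u

variable (N) in
/-- The `(K)`-orbit type subspace: all points whose isotropy group is conjugate to `K`. -/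
def orbitTypeSet (K : Subgroup G) : Set N :=
  {v | ∃ a : G, (MulAction.stabilizer G v).map (MulAut.conj a).toMonoidHom = K}

/-- The stratum of `u`: the `G`-orbit of the connected component containing `u` of the set of
points with the same orbit type as `u`. -/
def stratum (u : N) : Set N :=
  {v | ∃ g : G, ∃ w ∈ connectedComponentIn (orbitTypeSet G N (MulAction.stabilizer G u)) u,
    v = g • w}

/-- The stratum of `u` is locally minimal if there is an open invariant neighborhood of its closure
on which all orbit types are at least that of `u`. -/
def IsLocallyMinimal (u : N) : Prop :=
  ∃ U : Set N, IsOpen U ∧ IsInvariant G U ∧ closure (stratum G u) ⊆ U ∧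
    ∀ v ∈ U, OrbitTypeLE G u v

variable (N) in
/-- The number of locally minimal strata. -/
noncomputable def numLocallyMinimal : ℕ∞ :=
  {Z : Set N | ∃ u : N, Z = stratum G u ∧ IsLocallyMinimal G u}.encard

end EquivariantLS

namespace EquivariantLS

open Set Filter MulAction Topology

/-! Along a `G`-homotopy isotropy groups can only grow, so orbit types can only drop; near a locally
minimal stratum they cannot drop. By connectedness of `[0,1]`, a track starting in such a stratum
never leaves it (`IsGHomotopy.mem_stratum`). A categorical set meeting two locally minimal strata
moves points of both into one orbit. Strata are invariant and are equal once they meet, so the two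
coincide: assigning to each locally minimal stratum a covering set that meets it is injective.

For the second claim, compactness of `G` shows that orbit types do not rise when passing to a
closure; with local minimality, limit points of the stratum keep its orbit type and so belong to it.
The converse needs semicontinuity, `[u] ≤ [v]` for `v` near `u` (`eventually_orbitTypeLE`). This is
obtained without tubes: embed `N` in a Euclidean space and let the distance of two points be the
supremum over `G` of the distances of their translates, which is invariant. If `p` near `u` has a
unique nearest point on the orbit of `u`, the isotropy group of `p` fixes it. Uniqueness holds
because squared distance is strictly midpoint convex along a local parametrization of the orbit,
uniformly in the translating element; the constant rank of the orbit map provides the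
parametrization. -/

/-- In a compact group, a closed subgroup containing one of its conjugates equals it. -/
theorem map_conj_eq_of_le {G : Type*} [Group G] [TopologicalSpace G] [IsTopologicalGroup G]
    [CompactSpace G] {K : Subgroup G} (hK : IsClosed (K : Set G)) {a : G}
    (h : K.map (MulAut.conj a).toMonoidHom ≤ K) : K.map (MulAut.conj a).toMonoidHom = K := by
  refine le_antisymm h fun k hk => ?_
  have hclosed : IsClosed {g : G | g * k * g⁻¹ ∈ K} := hK.preimage (by fun_prop)
  have hpow : ∀ n : ℕ, a ^ n ∈ {g : G | g * k * g⁻¹ ∈ K} := by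
    intro n
    induction n with
    | zero => simpa using hk
    | succ n ih =>
      have := h (Subgroup.mem_map_of_mem _ ih)
      simpa [pow_succ', mul_assoc] using this
  -- In a compact group the inverse of `a` is a limit of nonnegative powers of `a`.
  have hinv : a⁻¹ ∈ closure (range (a ^ · : ℕ → G)) := by
    rw [← closure_range_zpow_eq_pow]
    exact subset_closure ⟨-1, by simp⟩
  have := closure_minimal (range_subset_iff.2 hpow) hclosed hinv
  exact ⟨a⁻¹ * k * a, by simpa using this, by simp [mul_assoc]⟩

/-! ### Orbit types and strata. -/

section Action

variable {G : Type*} [Group G] {N : Type*} [MulAction G N]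

theorem orbitTypeLE_iff {u v : N} :
    OrbitTypeLE G u v ↔ ∃ a : G, ∀ k : G, k • v = v → (a * k * a⁻¹) • u = u := by
  simp only [OrbitTypeLE, Subgroup.map_le_iff_le_comap]
  rfl

theorem OrbitTypeLE.trans {u v w : N} (huv : OrbitTypeLE G u v) (hvw : OrbitTypeLE G v w) :
    OrbitTypeLE G u w := by
  rw [orbitTypeLE_iff] at *
  obtain ⟨a, ha⟩ := huv
  obtain ⟨b, hb⟩ := hvw
  exact ⟨a * b, fun k hk => by simpa [mul_assoc] using ha _ (hb k hk)⟩

theorem orbitTypeLE_of_stabilizer_le {u v : N} (h : stabilizer G v ≤ stabilizer G u) :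
    OrbitTypeLE G u v :=
  orbitTypeLE_iff.2 ⟨1, fun k hk => by simpa using h hk⟩

theorem orbitTypeLE_smul_right {u v : N} (g : G) (h : OrbitTypeLE G u v) :
    OrbitTypeLE G u (g • v) := by
  rw [orbitTypeLE_iff] at *
  obtain ⟨a, ha⟩ := h
  refine ⟨a * g⁻¹, fun k hk => ?_⟩
  have : (g⁻¹ * k * g) • v = v := by rw [mul_smul, mul_smul, hk, inv_smul_smul]
  simpa [mul_assoc] using ha _ this

theorem orbitTypeLE_of_mem_orbitTypeSet {u v : N} (h : v ∈ orbitTypeSet G N (stabilizer G u)) :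
    OrbitTypeLE G u v ∧ OrbitTypeLE G v u := by
  obtain ⟨a, ha⟩ := h
  refine ⟨⟨a, ha.le⟩, a⁻¹, ?_⟩
  rw [← ha, Subgroup.map_map]
  rintro _ ⟨k, hk, rfl⟩
  simpa [mul_assoc] using hk

theorem self_mem_orbitTypeSet (u : N) : u ∈ orbitTypeSet G N (stabilizer G u) :=
  ⟨1, by ext; simp⟩

variable [TopologicalSpace N]

/-- The stratum of `u` consists of the points which some group element moves into a preconnected
set of points of the orbit type of `u` containing `u`. -/
theorem mem_stratum_iff {u v : N} : v ∈ stratum G u ↔ ∃ (g : G) (P : Set N),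
    IsPreconnected P ∧ P ⊆ orbitTypeSet G N (stabilizer G u) ∧ u ∈ P ∧ g • v ∈ P := by
  constructor
  · rintro ⟨g, w, hw, rfl⟩
    exact ⟨g⁻¹, _, isPreconnected_connectedComponentIn, connectedComponentIn_subset _ _,
      mem_connectedComponentIn (self_mem_orbitTypeSet u), by simpa using hw⟩
  · rintro ⟨g, P, hP, hPs, hu, hv⟩
    exact ⟨g⁻¹, g • v, hP.subset_connectedComponentIn hu hPs hv, by simp⟩

theorem self_mem_stratum (u : N) : u ∈ stratum G u :=
  mem_stratum_iff.2 ⟨1, {u}, isPreconnected_singleton, by simpa using self_mem_orbitTypeSet u,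
    rfl, by simp⟩

theorem smul_mem_stratum {u v : N} (g : G) (h : v ∈ stratum G u) : g • v ∈ stratum G u := by
  obtain ⟨a, w, hw, rfl⟩ := h
  exact ⟨g * a, w, hw, by rw [mul_smul]⟩

variable [TopologicalSpace G] [T2Space N] [ContinuousSMul G N]

theorem isClosed_stabilizer' (u : N) : IsClosed (stabilizer G u : Set G) :=
  isClosed_eq (by fun_prop : Continuous fun g : G => g • u) continuous_const

variable [IsTopologicalGroup G] [CompactSpace G]

theorem mem_orbitTypeSet_iff {u v : N} : v ∈ orbitTypeSet G N (stabilizer G u) ↔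
    OrbitTypeLE G u v ∧ OrbitTypeLE G v u := by
  refine ⟨orbitTypeLE_of_mem_orbitTypeSet, fun ⟨⟨a, ha⟩, b, hb⟩ => ⟨a, le_antisymm ha ?_⟩⟩
  -- Conjugating by `a * b` sends the isotropy group of `u` into itself, through a conjugate of that
  -- of `v`; by compactness the whole chain of inclusions collapses.
  have hle : (stabilizer G u).map (MulAut.conj (a * b)).toMonoidHom ≤
      (stabilizer G v).map (MulAut.conj a).toMonoidHom := by
    refine le_trans (le_of_eq ?_) (Subgroup.map_mono hb)
    rw [Subgroup.map_map]
    congr 1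
    ext
    simp [mul_assoc]
  rwa [map_conj_eq_of_le (isClosed_stabilizer' u) (hle.trans ha)] at hle

theorem orbitTypeSet_eq {u v : N} (h : v ∈ orbitTypeSet G N (stabilizer G u)) :
    orbitTypeSet G N (stabilizer G v) = orbitTypeSet G N (stabilizer G u) := by
  ext w
  rw [mem_orbitTypeSet_iff] at h
  simp only [mem_orbitTypeSet_iff]
  exact ⟨fun k => ⟨h.1.trans k.1, k.2.trans h.2⟩, fun k => ⟨h.2.trans k.1, k.2.trans h.1⟩⟩

theorem smul_mem_orbitTypeSet {u v : N} (g : G) (h : v ∈ orbitTypeSet G N (stabilizer G u)) :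
    g • v ∈ orbitTypeSet G N (stabilizer G u) := by
  rw [mem_orbitTypeSet_iff] at *
  refine ⟨orbitTypeLE_smul_right g h.1, ?_⟩
  have : OrbitTypeLE G (g • v) v := by
    simpa using orbitTypeLE_smul_right g⁻¹
      (orbitTypeLE_of_stabilizer_le (G := G) (le_refl (stabilizer G (g • v))))
  exact this.trans h.2

theorem stratum_subset_orbitTypeSet (u : N) :
    stratum G u ⊆ orbitTypeSet G N (stabilizer G u) := by
  intro v hv
  obtain ⟨g, P, -, hP, -, hv⟩ := mem_stratum_iff.1 hv
  simpa using smul_mem_orbitTypeSet g⁻¹ (hP hv)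

theorem mem_stratum_of_isPreconnected {u v w : N} {P : Set N} (hP : IsPreconnected P)
    (hPs : P ⊆ orbitTypeSet G N (stabilizer G u)) (hv : v ∈ stratum G u) (hvP : v ∈ P)
    (hw : w ∈ P) : w ∈ stratum G u := by
  obtain ⟨g, Q, hQ, hQs, hu, hg⟩ := mem_stratum_iff.1 hv
  refine mem_stratum_iff.2 ⟨g, Q ∪ (g • ·) '' P, ?_, ?_, Or.inl hu, Or.inr ⟨w, hw, rfl⟩⟩
  · exact hQ.union (g • v) hg ⟨v, hvP, rfl⟩ (hP.image _ (by fun_prop))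
  · refine union_subset hQs ?_
    rintro _ ⟨x, hx, rfl⟩
    exact smul_mem_orbitTypeSet g (hPs hx)

theorem mem_stratum_symm {u v : N} (h : v ∈ stratum G u) : u ∈ stratum G v := by
  have hT := orbitTypeSet_eq (stratum_subset_orbitTypeSet u h)
  obtain ⟨g, P, hP, hPs, hu, hv⟩ := mem_stratum_iff.1 h
  refine mem_stratum_of_isPreconnected hP (hPs.trans hT.ge)
    (smul_mem_stratum g (self_mem_stratum v)) hv hu

theorem mem_stratum_trans {u v w : N} (h : v ∈ stratum G u) (hw : w ∈ stratum G v) :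
    w ∈ stratum G u := by
  have hT := orbitTypeSet_eq (stratum_subset_orbitTypeSet u h)
  obtain ⟨g, P, hP, hPs, hv, hw⟩ := mem_stratum_iff.1 hw
  simpa using smul_mem_stratum g⁻¹
    (mem_stratum_of_isPreconnected hP (hPs.trans hT.le) h hv hw)

theorem stratum_eq_of_mem {u v : N} (h : v ∈ stratum G u) : stratum G v = stratum G u :=
  Subset.antisymm (fun _ => mem_stratum_trans h) fun _ => mem_stratum_trans (mem_stratum_symm h)

/-! ### Closures of strata and the homotopy bound. -/

/-- The conjugating element may vary along a limit. Recording it as a coordinate gives a closed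
condition on `G × N`, and projection along the compact factor `G` is a closed map. -/
theorem orbitTypeLE_of_mem_closure {u v : N}
    (h : v ∈ closure (orbitTypeSet G N (stabilizer G u))) : OrbitTypeLE G v u := by
  let S : Set (G × N) := {p | ∀ k : G, k • u = u → (p.1 * k * p.1⁻¹) • p.2 = p.2}
  have hS : IsClosed S := by
    simp only [S, ofPred_forall]
    exact isClosed_iInter fun k => isClosed_iInter fun _ => isClosed_eq (by fun_prop) (by fun_prop)
  have hproj : IsClosed (Prod.snd '' S) := isClosedMap_snd_of_compactSpace _ hS
  have hsub : orbitTypeSet G N (stabilizer G u) ⊆ Prod.snd '' S := by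
    intro w hw
    obtain ⟨a, ha⟩ := orbitTypeLE_iff.1 (mem_orbitTypeSet_iff.1 hw).2
    exact ⟨(a, w), ha, rfl⟩
  obtain ⟨⟨a, w⟩, ha, rfl⟩ := closure_minimal hsub hproj h
  exact orbitTypeLE_iff.2 ⟨a, ha⟩

theorem mem_stratum_of_mem_closure [CompactSpace N] {u v : N} (h : v ∈ closure (stratum G u))
    (hv : v ∈ orbitTypeSet G N (stabilizer G u)) : v ∈ stratum G u := by
  set C := connectedComponentIn (orbitTypeSet G N (stabilizer G u)) u with hC
  have hcpt : IsCompact ((fun p : G × N => p.1 • p.2) '' (univ ×ˢ closure C)) :=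
    (isCompact_univ.prod isClosed_closure.isCompact).image (by fun_prop)
  have hsub : stratum G u ⊆ (fun p : G × N => p.1 • p.2) '' (univ ×ˢ closure C) := by
    rintro _ ⟨g, w, hw, rfl⟩
    exact ⟨(g, w), ⟨mem_univ _, subset_closure hw⟩, rfl⟩
  obtain ⟨⟨g, w⟩, ⟨-, hw⟩, rfl⟩ := closure_minimal hsub hcpt.isClosed h
  have hwT : w ∈ orbitTypeSet G N (stabilizer G u) := by
    simpa using smul_mem_orbitTypeSet g⁻¹ hv
  -- A set between a connected set and its closure is connected, so the component already contains
  -- its limit points of the same orbit type.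
  have hpre : IsPreconnected (insert w C) :=
    isPreconnected_connectedComponentIn.subset_closure (subset_insert _ _)
      (insert_subset hw subset_closure)
  exact ⟨g, w, hpre.subset_connectedComponentIn
    (mem_insert_of_mem _ (mem_connectedComponentIn (self_mem_orbitTypeSet u)))
    (insert_subset hwT (connectedComponentIn_subset _ _)) (mem_insert _ _), rfl⟩

theorem IsLocallyMinimal.isClosed [CompactSpace N] {u : N} (h : IsLocallyMinimal G u) :
    IsClosed (stratum G u) := by
  obtain ⟨U, -, -, hcl, hU⟩ := h
  refine isClosed_of_closure_subset fun v hv => mem_stratum_of_mem_closure hv ?_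
  exact mem_orbitTypeSet_iff.2 ⟨hU v (hcl hv),
    orbitTypeLE_of_mem_closure (closure_mono (stratum_subset_orbitTypeSet u) hv)⟩

theorem isLocallyMinimal_of_isClosed
    (hsemi : ∀ u : N, ∀ᶠ v in 𝓝 u, OrbitTypeLE G u v) {u : N} (h : IsClosed (stratum G u)) :
    IsLocallyMinimal G u := by
  -- The largest candidate: the interior of the set where orbit types are at least that of `u`.
  refine ⟨{w | ∀ᶠ v in 𝓝 w, OrbitTypeLE G u v}, isOpen_setOfPred_eventually_nhds, ?_, ?_,
    fun v hv => hv.self_of_nhds⟩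
  · intro g w hw
    have hc : Tendsto (fun x : N => g⁻¹ • x) (𝓝 (g • w)) (𝓝 w) := by
      have : Continuous fun x : N => g⁻¹ • x := by fun_prop
      simpa using this.tendsto (g • w)
    refine (hc.eventually hw).mono fun x hx => ?_
    simpa using orbitTypeLE_smul_right g hx
  · rw [h.closure_eq]
    intro w hw
    exact (hsemi w).mono fun v hv =>
      (mem_orbitTypeSet_iff.1 (stratum_subset_orbitTypeSet u hw)).1.trans hv

/-- A `G`-homotopy cannot move a point out of a locally minimal stratum. -/
theorem IsGHomotopy.mem_stratum [CompactSpace N] {U : Set N} {H : U × unitInterval → N}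
    (hH : IsGHomotopy G U H) {u : N} (hu : IsLocallyMinimal G u) {x : U}
    (hx : (x : N) ∈ stratum G u) (t : unitInterval) : H (x, t) ∈ stratum G u := by
  have hclosed := hu.isClosed
  obtain ⟨V, hV, -, hcl, hVu⟩ := hu
  have hcont : Continuous fun t => H (x, t) := hH.continuous.comp (by fun_prop)
  have hle : ∀ t, OrbitTypeLE G (H (x, t)) u := by
    intro t
    refine OrbitTypeLE.trans (orbitTypeLE_of_stabilizer_le fun k hk => ?_)
      (mem_orbitTypeSet_iff.1 (stratum_subset_orbitTypeSet u hx)).2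
    exact (hH.equivariant k x x t (mem_stabilizer_iff.1 hk).symm).symm
  have hclopen : IsClopen {t | H (x, t) ∈ stratum G u} := by
    refine ⟨hclosed.preimage hcont, isOpen_iff_mem_nhds.2 fun t ht => ?_⟩
    have hnhds : (fun t => H (x, t)) ⁻¹' V ∈ 𝓝 t :=
      (hV.preimage hcont).mem_nhds (hcl (subset_closure ht))
    -- A short interval of times around `t` gives a connected piece of the track inside `V`, where
    -- both orbit type inequalities hold; it therefore stays in one stratum.
    obtain ⟨b, c, htJ, hJ, hJV⟩ := exists_Icc_mem_subset_of_mem_nhds hnhds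
    filter_upwards [hJ] with s hs
    refine mem_stratum_of_isPreconnected (isPreconnected_Icc.image _ hcont.continuousOn) ?_ ht
      ⟨t, htJ, rfl⟩ ⟨s, hs, rfl⟩
    rintro _ ⟨s, hs, rfl⟩
    exact mem_orbitTypeSet_iff.2 ⟨hVu _ (hJV hs), hle s⟩
  have := hclopen.eq_univ ⟨0, by simpa [hH.initial] using hx⟩
  exact this.ge (mem_univ t)

theorem numLocallyMinimal_le_gCat [CompactSpace N] : numLocallyMinimal G N ≤ gCat G N := by
  refine le_sInf ?_
  rintro _ ⟨C, hC, hcov, rfl⟩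
  have hex : ∀ u : N, ∃ U ∈ C, u ∈ U := fun u => by
    simpa using (hcov.ge (mem_univ u) : u ∈ ⋃₀ C)
  choose c hcC hc using hex
  rcases isEmpty_or_nonempty N with hN | hN
  · simp [numLocallyMinimal]
  choose! r hr using fun (Z : Set N) (hZ : ∃ u : N, Z = stratum G u ∧ IsLocallyMinimal G u) => hZ
  refine encard_le_encard_of_injOn (f := fun Z => c (r Z)) (fun Z _ => hcC _) ?_
  intro Z hZ Z' hZ' heq
  obtain ⟨-, -, H, hH, w, hw⟩ := hC _ (hcC (r Z))
  have h1 := hH.mem_stratum (hr Z hZ).2 (x := ⟨r Z, hc _⟩) (self_mem_stratum _) 1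
  have h2 := hH.mem_stratum (hr Z' hZ').2 (x := ⟨r Z', by
    simpa only [heq] using hc (r Z')⟩) (self_mem_stratum _) 1
  obtain ⟨a, ha⟩ := hw ⟨r Z, hc _⟩
  obtain ⟨b, hb⟩ := hw ⟨r Z', by simpa only [heq] using hc (r Z')⟩
  rw [← ha] at h1
  rw [← hb] at h2
  have h1' := smul_mem_stratum a⁻¹ h1
  have h2' := smul_mem_stratum b⁻¹ h2
  simp only [inv_smul_smul] at h1' h2'
  rw [(hr Z hZ).1, (hr Z' hZ').1, ← stratum_eq_of_mem h1', stratum_eq_of_mem h2']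

end Action

/-! ### Constant rank and transversals to the kernel. -/

section Calculus

variable {F W : Type*} [NormedAddCommGroup F] [NormedSpace ℝ F] [FiniteDimensional ℝ F]

/-- Every linear map of vector spaces has a reflexive generalized inverse. -/
theorem exists_generalized_inverse {V W : Type*} [AddCommGroup V] [Module ℝ V] [AddCommGroup W]
    [Module ℝ W] (L : V →ₗ[ℝ] W) :
    ∃ R : W →ₗ[ℝ] V, (∀ x, L (R (L x)) = L x) ∧ ∀ y, R (L (R y)) = R y := by
  obtain ⟨S, hS⟩ := Submodule.exists_isCompl (LinearMap.ker L)
  have hinj : LinearMap.ker (L.comp S.subtype) = ⊥ := by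
    rw [LinearMap.ker_eq_bot']
    rintro ⟨s, hs⟩ h
    have : s ∈ LinearMap.ker L ⊓ S := ⟨h, hs⟩
    rw [hS.inf_eq_bot] at this
    simpa using this
  obtain ⟨R, hR⟩ := LinearMap.exists_leftInverse_of_injective _ hinj
  have hRs : ∀ s : S, R (L s) = s := fun s => LinearMap.congr_fun hR s
  refine ⟨S.subtype.comp R, fun x => ?_, fun y => by simp [hRs]⟩
  have hx : x ∈ LinearMap.ker L ⊔ S := by rw [hS.sup_eq_top]; trivial
  obtain ⟨k, hk, s, hs, rfl⟩ := Submodule.mem_sup.1 hx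
  simp [LinearMap.mem_ker.1 hk, hRs ⟨s, hs⟩]

/-- Applying `R ∘ L` to `hA` gives `R B A = R L`, so `R` maps the range of `B` onto that of `R`. The
rank bound makes this surjection injective, so `R B A q = R L q = 0` forces `B A q = 0`. In use, `L`
and `B` are derivatives at the base point and nearby, and `A` is the derivative of a local inverse.
-/
theorem apply_eq_zero_of_finrank_range_le {V W : Type*} [AddCommGroup V] [Module ℝ V]
    [AddCommGroup W] [Module ℝ W] [FiniteDimensional ℝ V] {L B : V →ₗ[ℝ] W}
    {R : W →ₗ[ℝ] V} {A : V →ₗ[ℝ] V} (hL : ∀ x, L (R (L x)) = L x) (hR : ∀ y, R (L (R y)) = R y)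
    (hA : ∀ x, R (B (A x)) + (A x - R (L (A x))) = x)
    (hrank : Module.finrank ℝ (LinearMap.range B) ≤ Module.finrank ℝ (LinearMap.range L))
    {q : V} (hq : R (L q) = 0) : B (A q) = 0 := by
  have hRBA : ∀ x, R (B (A x)) = R (L x) := by
    intro x
    have := congrArg (fun z => R (L z)) (hA x)
    simpa [hL, hR] using this
  let T : LinearMap.range B →ₗ[ℝ] LinearMap.range R :=
    (R.domRestrict _).codRestrict _ fun x => ⟨x, rfl⟩
  have hT : Function.Surjective T := by
    rintro ⟨_, y, rfl⟩
    exact ⟨⟨B (A (R y)), _, rfl⟩, Subtype.ext ((hRBA (R y)).trans (hR y))⟩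
  have hLR : Module.finrank ℝ (LinearMap.range L) ≤ Module.finrank ℝ (LinearMap.range R) := by
    have : LinearMap.range L = (LinearMap.range R).map L := by
      ext y
      constructor
      · rintro ⟨x, rfl⟩
        exact ⟨R (L x), ⟨_, rfl⟩, hL x⟩
      · rintro ⟨x, -, rfl⟩
        exact ⟨x, rfl⟩
    rw [this]
    exact Submodule.finrank_map_le _ _
  have hTi : Function.Injective T :=
    (LinearMap.injective_iff_surjective_of_finrank_eq_finrank
      (le_antisymm (hrank.trans hLR) (LinearMap.finrank_le_finrank_of_surjective hT))).2 hT
  have h0 : (⟨B (A q), _, rfl⟩ : LinearMap.range B) = 0 :=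
    (map_eq_zero_iff T hTi).1 (Subtype.ext ((hRBA q).trans hq))
  exact congrArg Subtype.val h0

variable [NormedAddCommGroup W] [NormedSpace ℝ W] [FiniteDimensional ℝ W]

/-- Local form of the image of a map whose rank is maximal at `x₀`: near `x₀` all values are taken
on the affine space through `x₀` directed by a complement of the kernel of the derivative. -/
theorem exists_transversal_of_finrank_range_le {f : F → W} {x₀ : F} (hf : ContDiffAt ℝ 1 f x₀)
    (hrank : ∀ᶠ x in 𝓝 x₀, Module.finrank ℝ (LinearMap.range (fderiv ℝ f x : F →ₗ[ℝ] W)) ≤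
      Module.finrank ℝ (LinearMap.range (fderiv ℝ f x₀ : F →ₗ[ℝ] W))) :
    ∃ S : Submodule ℝ F, (∀ s ∈ S, fderiv ℝ f x₀ s = 0 → s = 0) ∧
      ∀ U ∈ 𝓝 x₀, ∀ᶠ x in 𝓝 x₀, ∃ z ∈ U, z - x₀ ∈ S ∧ f z = f x := by
  set L := fderiv ℝ f x₀ with hLdef
  obtain ⟨R', hL, hR⟩ := exists_generalized_inverse (L : F →ₗ[ℝ] W)
  set R : W →L[ℝ] F := LinearMap.toContinuousLinearMap R' with hRdef
  replace hL : ∀ x, L (R (L x)) = L x := hL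
  replace hR : ∀ y, R (L (R y)) = R y := hR
  refine ⟨LinearMap.range (R : W →ₗ[ℝ] F), ?_, fun U hU => ?_⟩
  · rintro _ ⟨y, rfl⟩ h
    have := hR y
    simp only [ContinuousLinearMap.coe_coe] at h ⊢
    rw [← this, h, map_zero]
  set Q : F →L[ℝ] F := ContinuousLinearMap.id ℝ F - R.comp L with hQ
  -- Since `Q = 1 - R L`, the derivative of `φ` at `x₀` is the identity. In the resulting
  -- coordinates, `f` does not depend on the directions in the kernel of `R L`.
  set φ : F → F := fun x => R (f x) + Q x with hφ
  have hφd : ∀ x, DifferentiableAt ℝ f x → HasFDerivAt φ (R.comp (fderiv ℝ f x) + Q) x :=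
    fun x hx => (R.hasFDerivAt.comp x hx.hasFDerivAt).add Q.hasFDerivAt
  have hφc : ContDiffAt ℝ 1 φ x₀ := (R.contDiff.contDiffAt.comp x₀ hf).add Q.contDiff.contDiffAt
  have hφ0 : HasFDerivAt φ ((ContinuousLinearEquiv.refl ℝ F : F ≃L[ℝ] F) : F →L[ℝ] F) x₀ := by
    convert! hφd x₀ (hf.differentiableAt one_ne_zero) using 1
    ext x
    simp [hQ, hLdef]
  have hφs := hφc.hasStrictFDerivAt' hφ0 one_ne_zero
  set j : F → F := hφc.localInverse hφ0 one_ne_zero with hj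
  have hjc : ContDiffAt ℝ 1 j (φ x₀) := hφc.to_localInverse hφ0 one_ne_zero
  have hj0 : j (φ x₀) = x₀ := hφc.localInverse_apply_image hφ0 one_ne_zero
  have hright : ∀ᶠ y in 𝓝 (φ x₀), φ (j y) = y := hφs.eventually_right_inverse
  have hleft : ∀ᶠ x in 𝓝 x₀, j (φ x) = x := hφs.eventually_left_inverse
  have hjt : Tendsto j (𝓝 (φ x₀)) (𝓝 x₀) := by simpa only [hj0] using hjc.continuousAt.tendsto
  have hRφ : ∀ x, R (L (φ x)) = R (f x) := by intro x; simp [hφ, hQ, hR, hL]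
  have hderiv : ∀ᶠ y in 𝓝 (φ x₀), DifferentiableAt ℝ (f ∘ j) y ∧ j y ∈ U ∧ φ (j y) = y ∧
      ∀ q, R (L q) = 0 → fderiv ℝ (f ∘ j) y q = 0 := by
    filter_upwards [hjt.eventually hrank, hright.eventually_nhds, hjt.eventually hU,
      hjt.eventually ((hf.eventually (by simp)).mono fun x hx => hx.differentiableAt one_ne_zero),
      (hjc.eventually (by simp)).mono fun x hx => hx.differentiableAt one_ne_zero]
      with y hy1 hy2 hyU hy3 hy4
    have hcomp := hy3.hasFDerivAt.comp y hy4.hasFDerivAt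
    refine ⟨hcomp.differentiableAt, hyU, hy2.self_of_nhds, fun q hq => ?_⟩
    rw [hcomp.fderiv]
    have hid : (R.comp (fderiv ℝ f (j y)) + Q).comp (fderiv ℝ j y) =
        ContinuousLinearMap.id ℝ F :=
      ((hφd _ hy3).comp y hy4.hasFDerivAt).unique
        ((hasFDerivAt_id y).congr_of_eventuallyEq hy2)
    exact apply_eq_zero_of_finrank_range_le (L := (L : F →ₗ[ℝ] W))
      (B := (fderiv ℝ f (j y) : F →ₗ[ℝ] W)) (R := (R : W →ₗ[ℝ] F))
      (A := (fderiv ℝ j y : F →ₗ[ℝ] F)) hL hR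
      (fun x => by simpa [hQ] using DFunLike.congr_fun hid x) hy1 hq
  obtain ⟨ε, hε, hball⟩ := Metric.eventually_nhds_iff_ball.1 hderiv
  have hend : ∀ᶠ x in 𝓝 x₀, R (f x) + Q x₀ ∈ Metric.ball (φ x₀) ε := by
    have hc : ContinuousAt (fun x => R (f x) + Q x₀) x₀ :=
      (R.continuous.continuousAt.comp hf.continuousAt).add continuousAt_const
    exact hc.eventually (Metric.ball_mem_nhds _ hε)
  filter_upwards [hleft, hend, hφc.continuousAt.eventually (Metric.ball_mem_nhds _ hε)]
    with x hx hx0 hx1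
  -- Replacing `Q x` by `Q x₀` moves `φ x` along the kernel of `R L`, which does not change `f ∘ j`,
  -- and puts `j y₀ - x₀` in the range of `R`.
  set y₀ := R (f x) + Q x₀ with hy₀
  have hseg : ∀ y ∈ segment ℝ y₀ (φ x), y ∈ Metric.ball (φ x₀) ε :=
    (convex_ball _ _).segment_subset hx0 hx1
  have hdir : ∀ c : ℝ, R (L (c • (φ x - y₀))) = 0 := by
    intro c
    simp [hφ, hy₀, hQ, hL]
  have hconst : (f ∘ j) (φ x) = (f ∘ j) y₀ := by
    let γ : ℝ → F := fun τ => y₀ + τ • (φ x - y₀)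
    have hγ : ∀ τ ∈ Icc (0 : ℝ) 1, γ τ ∈ Metric.ball (φ x₀) ε := fun τ hτ =>
      hseg _ (by rw [segment_eq_image']; exact ⟨τ, hτ, rfl⟩)
    have hd : ∀ τ ∈ Icc (0 : ℝ) 1, HasDerivWithinAt ((f ∘ j) ∘ γ) 0 (Icc 0 1) τ := by
      intro τ hτ
      have hγd : HasDerivAt γ (φ x - y₀) τ := by
        have h := ((hasDerivAt_id τ).smul_const (φ x - y₀)).const_add y₀
        rwa [one_smul] at h
      have h := (hball _ (hγ τ hτ)).1.hasFDerivAt.comp_hasDerivAt τ hγd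
      rw [(hball _ (hγ τ hτ)).2.2.2 _ (by simpa using hdir 1)] at h
      exact h.hasDerivWithinAt
    have := norm_image_sub_le_of_norm_deriv_le_segment_01' (C := 0) hd (by simp)
    simpa [γ, sub_eq_zero] using this
  have hy := hball y₀ hx0
  refine ⟨j y₀, hy.2.1, ?_, ?_⟩
  · have h1 : Q (j y₀) = Q x₀ := by
      have h2 := congrArg Q hy.2.2.1
      simpa [hφ, hy₀, hQ, hL, hR] using h2
    have h3 : j y₀ - x₀ = R (L (j y₀ - x₀)) := by
      have : Q (j y₀ - x₀) = 0 := by rw [map_sub, h1, sub_self]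
      simpa [hQ, sub_eq_zero] using this
    rw [h3]
    exact ⟨_, rfl⟩
  · simpa [hx] using hconst.symm

end Calculus

/-! ### Strict midpoint convexity of squared distance. -/

section Midpoint

variable {Z W : Type*} [NormedAddCommGroup Z] [NormedSpace ℝ Z] [FiniteDimensional ℝ Z]
  [NormedAddCommGroup W] [InnerProductSpace ℝ W]

/-- If `y` is close to the midpoint of `x₁` and `x₂`, then its squared distance to a point `a` is
less than the mean of the squared distances of `x₁` and `x₂` to `a`. -/
theorem norm_sub_sq_lt_of_near_midpoint {a x₁ x₂ y : W} {c K δ ξ : ℝ} (hc : 0 ≤ c)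
    (hδ : 0 ≤ δ) (hξ : 0 < ξ) (hξδ : ξ ≤ δ) (hδc : 2 * δ * K + K ^ 2 * δ ^ 2 < c ^ 2 / 4)
    (h₁ : ‖a - x₁‖ ≤ δ) (h₂ : ‖a - x₂‖ ≤ δ)
    (hy : ‖(1 / 2 : ℝ) • (x₁ + x₂) - y‖ ≤ K * ξ ^ 2) (hx : c * ξ ≤ ‖x₁ - x₂‖) :
    ‖a - y‖ ^ 2 < (‖a - x₁‖ ^ 2 + ‖a - x₂‖ ^ 2) / 2 := by
  set e := (1 / 2 : ℝ) • (x₁ + x₂) - y with he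
  set v := (1 / 2 : ℝ) • ((a - x₁) + (a - x₂)) with hv
  have hhalf : ‖(1 / 2 : ℝ)‖ = 1 / 2 := by norm_num
  have hvδ : ‖v‖ ≤ δ := by
    rw [hv, norm_smul, hhalf]
    linarith [norm_add_le (a - x₁) (a - x₂)]
  have hav : a - y = v + e := by rw [hv, he]; module
  -- The parallelogram law gains at least `c ^ 2 * ξ ^ 2 / 4`; `hδc` says exactly that this beats
  -- the error from `e`.
  have hpar : ‖v‖ ^ 2 = (‖a - x₁‖ ^ 2 + ‖a - x₂‖ ^ 2) / 2 - ‖x₁ - x₂‖ ^ 2 / 4 := by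
    have h7 := parallelogram_law_with_norm ℝ (a - x₁) (a - x₂)
    have h8 : a - x₁ - (a - x₂) = -(x₁ - x₂) := by abel
    rw [h8, norm_neg] at h7
    rw [hv, norm_smul, hhalf]
    linarith
  have h9 : ‖v + e‖ ^ 2 ≤ ‖v‖ ^ 2 + 2 * δ * ‖e‖ + ‖e‖ ^ 2 := by
    calc ‖v + e‖ ^ 2 ≤ (‖v‖ + ‖e‖) ^ 2 := by gcongr; exact norm_add_le _ _
      _ = ‖v‖ ^ 2 + 2 * ‖v‖ * ‖e‖ + ‖e‖ ^ 2 := by ring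
      _ ≤ _ := by gcongr
  have h10 : ‖e‖ ^ 2 ≤ K ^ 2 * δ ^ 2 * ξ ^ 2 := by
    calc ‖e‖ ^ 2 ≤ (K * ξ ^ 2) ^ 2 := by gcongr
      _ = K ^ 2 * ξ ^ 2 * ξ ^ 2 := by ring
      _ ≤ _ := by gcongr
  have h11 : 2 * δ * ‖e‖ ≤ 2 * δ * (K * ξ ^ 2) := by gcongr
  have h12 : (c * ξ) ^ 2 ≤ ‖x₁ - x₂‖ ^ 2 := by gcongr
  have h13 := mul_lt_mul_of_pos_right hδc (pow_pos hξ 2)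
  rw [hav]
  linarith

/-- Along directions in which the derivative of `Θ` is injective, the squared distance to a point
near `Θ z₀` is strictly midpoint convex near `z₀`. -/
theorem eventually_norm_sub_midpoint_sq_lt {Θ : Z → W} {z₀ : Z} (hΘ : ContDiffAt ℝ 2 Θ z₀)
    {S : Submodule ℝ Z} (hS : ∀ s ∈ S, fderiv ℝ Θ z₀ s = 0 → s = 0) :
    ∀ᶠ q : W × Z × Z in 𝓝 (Θ z₀, z₀, z₀), q.2.1 - q.2.2 ∈ S → q.2.1 ≠ q.2.2 →
      ‖q.1 - Θ (midpoint ℝ q.2.1 q.2.2)‖ ^ 2 <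
        (‖q.1 - Θ q.2.1‖ ^ 2 + ‖q.1 - Θ q.2.2‖ ^ 2) / 2 := by
  set D := fderiv ℝ Θ z₀ with hD
  obtain ⟨c, hc, hcD⟩ : ∃ c : ℝ, 0 < c ∧ ∀ s ∈ S, c * ‖s‖ ≤ ‖D s‖ := by
    have hker : LinearMap.ker ((D : Z →ₗ[ℝ] W).comp S.subtype) = ⊥ := by
      rw [LinearMap.ker_eq_bot']
      rintro ⟨s, hs⟩ h
      exact Subtype.ext (hS s hs h)
    obtain ⟨K, hK, hA⟩ := LinearMap.exists_antilipschitzWith _ hker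
    refine ⟨(K : ℝ)⁻¹, by positivity, fun s hs => ?_⟩
    have := hA.le_mul_dist ⟨s, hs⟩ 0
    rw [dist_zero_right, map_zero, dist_zero_right] at this
    rw [inv_mul_le_iff₀ (by positivity)]
    exact this
  obtain ⟨K, t, ht, hKt⟩ :=
    (hΘ.fderiv_right (m := 1) (by norm_num)).exists_lipschitzOnWith
  have hdiff : ∀ᶠ z in 𝓝 z₀, DifferentiableAt ℝ Θ z :=
    (hΘ.eventually (by simp)).mono fun z hz => hz.differentiableAt two_ne_zero
  obtain ⟨r, hr, hball⟩ := Metric.eventually_nhds_iff_ball.1 (hdiff.and ht)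
  obtain ⟨δ, hδ, hδc⟩ : ∃ δ : ℝ, 0 < δ ∧ 2 * δ * K + K ^ 2 * δ ^ 2 < c ^ 2 / 4 := by
    have hcont : ContinuousAt (fun δ : ℝ => 2 * δ * K + K ^ 2 * δ ^ 2) 0 := by fun_prop
    have := hcont.eventually (gt_mem_nhds (by simp; positivity) : ∀ᶠ y in _, y < c ^ 2 / 4)
    obtain ⟨δ, h1, h2⟩ := ((this.filter_mono nhdsWithin_le_nhds).and self_mem_nhdsWithin :
      ∀ᶠ δ in 𝓝[>] (0 : ℝ), _ ∧ δ ∈ Ioi 0).exists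
    exact ⟨δ, h2, h1⟩
  -- With `‖z₁ - z₂‖ = 2 * ‖ξ‖`, an error factor `c / 2` leaves the lower bound `c * ‖ξ‖` on `‖Θ z₁
  -- - Θ z₂‖`.
  have hstrict : ∀ᶠ q : Z × Z in 𝓝 (z₀, z₀), ‖Θ q.1 - Θ q.2 - D (q.1 - q.2)‖ ≤
      c / 2 * ‖q.1 - q.2‖ :=
    (hΘ.hasStrictFDerivAt two_ne_zero).isLittleO.def (half_pos hc)
  have e1 : Tendsto (fun q : W × Z × Z => q.2) (𝓝 (Θ z₀, z₀, z₀)) (𝓝 (z₀, z₀)) :=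
    continuous_snd.tendsto _
  have e2 : ∀ᶠ z in 𝓝 z₀, z ∈ Metric.ball z₀ (min r δ) :=
    Metric.ball_mem_nhds _ (lt_min hr hδ)
  have e3 : Tendsto (fun q : W × Z × Z => q.2.1) (𝓝 (Θ z₀, z₀, z₀)) (𝓝 z₀) :=
    (continuous_fst.comp continuous_snd).tendsto _
  have e4 : Tendsto (fun q : W × Z × Z => q.2.2) (𝓝 (Θ z₀, z₀, z₀)) (𝓝 z₀) :=
    (continuous_snd.comp continuous_snd).tendsto _
  have e5 : ∀ (p : W × Z × Z → Z), Tendsto p (𝓝 (Θ z₀, z₀, z₀)) (𝓝 z₀) →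
      ∀ᶠ q in 𝓝 (Θ z₀, z₀, z₀), ‖q.1 - Θ (p q)‖ < δ := by
    intro p hp
    have : Tendsto (fun q : W × Z × Z => ‖q.1 - Θ (p q)‖) (𝓝 (Θ z₀, z₀, z₀)) (𝓝 0) := by
      have h := ((continuous_fst.tendsto (Θ z₀, z₀, z₀)).sub
        (hΘ.continuousAt.tendsto.comp hp)).norm
      simpa using h
    exact this.eventually (gt_mem_nhds hδ)
  filter_upwards [e1.eventually hstrict, e3.eventually e2, e4.eventually e2, e5 _ e3, e5 _ e4]
    with ⟨a, z₁, z₂⟩ h1 h2 h3 h4 h5 hmem hne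
  simp only at h1 h2 h3 h4 h5 hmem hne ⊢
  set m := midpoint ℝ z₁ z₂ with hm
  set ξ := (1 / 2 : ℝ) • (z₁ - z₂) with hξ
  have hz1 : z₁ - m = ξ := by rw [hm, hξ, midpoint_eq_smul_add, invOf_eq_inv]; module
  have hz2 : z₂ - m = -ξ := by rw [hm, hξ, midpoint_eq_smul_add, invOf_eq_inv]; module
  have hz12 : ‖z₁ - z₂‖ = 2 * ‖ξ‖ := by rw [hξ, norm_smul]; norm_num; ring
  have hξ0 : 0 < ‖ξ‖ := by
    have : 0 < ‖z₁ - z₂‖ := norm_pos_iff.2 (sub_ne_zero.2 hne)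
    linarith
  have hξδ : ‖ξ‖ < δ := by
    have h6 : dist z₁ z₂ < min r δ + min r δ :=
      (dist_triangle_right _ _ z₀).trans_lt (add_lt_add h2 h3)
    rw [dist_eq_norm, hz12] at h6
    linarith [min_le_right r δ]
  have hlow : c * ‖ξ‖ ≤ ‖Θ z₁ - Θ z₂‖ := by
    have h6 := hcD _ hmem
    have h7 := norm_sub_norm_le (D (z₁ - z₂)) (Θ z₁ - Θ z₂)
    rw [norm_sub_rev (D _)] at h7
    rw [hz12] at h1 h6
    linarith
  have hsub : segment ℝ z₁ z₂ ⊆ Metric.ball z₀ r :=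
    (convex_ball _ _).segment_subset (Metric.ball_subset_ball (min_le_left _ _) h2)
      (Metric.ball_subset_ball (min_le_left _ _) h3)
  have hmseg : m ∈ segment ℝ z₁ z₂ := midpoint_mem_segment _ _
  have hsecond : ∀ z ∈ segment ℝ z₁ z₂,
      ‖Θ z - Θ m - fderiv ℝ Θ m (z - m)‖ ≤ K * ‖ξ‖ * ‖z - m‖ := by
    intro z hz
    refine (convex_segment z₁ z₂).norm_image_sub_le_of_norm_fderiv_le'
      (fun y hy => (hball y (hsub hy)).1) (fun y hy => ?_) hmseg hz
    have h6 := hKt.dist_le_mul y (hball y (hsub hy)).2 m (hball m (hsub hmseg)).2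
    rw [dist_eq_norm, dist_eq_norm] at h6
    refine h6.trans ?_
    gcongr
    have h8 : segment ℝ z₁ z₂ ⊆ Metric.closedBall m ‖ξ‖ :=
      (convex_closedBall _ _).segment_subset (by simp [dist_eq_norm, hz1])
        (by simp [dist_eq_norm, hz2])
    simpa [dist_eq_norm] using h8 hy
  have hs1 := hsecond z₁ (left_mem_segment _ _ _)
  have hs2 := hsecond z₂ (right_mem_segment _ _ _)
  rw [hz1] at hs1
  rw [hz2, norm_neg, map_neg] at hs2
  -- The linear terms at `ξ` and `-ξ` cancel, leaving only a second-order error.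
  have hsum : ‖(1 / 2 : ℝ) • (Θ z₁ + Θ z₂) - Θ m‖ ≤ K * ‖ξ‖ ^ 2 := by
    have h6 : (1 / 2 : ℝ) • (Θ z₁ + Θ z₂) - Θ m = (1 / 2 : ℝ) •
        ((Θ z₁ - Θ m - fderiv ℝ Θ m ξ) + (Θ z₂ - Θ m - -fderiv ℝ Θ m ξ)) := by module
    rw [h6, norm_smul]
    have h7 := norm_add_le (Θ z₁ - Θ m - fderiv ℝ Θ m ξ) (Θ z₂ - Θ m - -fderiv ℝ Θ m ξ)
    have : ‖(1 / 2 : ℝ)‖ = 1 / 2 := by norm_num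
    rw [this]
    linarith
  exact norm_sub_sq_lt_of_near_midpoint hc.le hδ.le hξ0 hξδ.le hδc h4.le h5.le hsum hlow

end Midpoint

/-! ### Openness of orbit maps. -/

section Slice

open scoped Pointwise

variable {G : Type*} [Group G] [TopologicalSpace G] [IsTopologicalGroup G] [CompactSpace G]
  {N : Type*} [TopologicalSpace N] [T2Space N] [MulAction G N] [ContinuousSMul G N]

/-- The orbit map of a compact group is open onto the orbit. -/
theorem eventually_exists_smul_eq {u : N} {U : Set G} (hU : U ∈ 𝓝 (1 : G)) :
    ∀ᶠ v in 𝓝 u, v ∈ orbit G u → ∃ g ∈ U, g • u = v := by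
  -- Group elements outside `interior U` times the isotropy group move `u` into a compact set
  -- missing `u`; the complement of that set is the required neighborhood.
  have hcl : IsClosed ((fun g : G => g • u) '' (interior U * (stabilizer G u : Set G))ᶜ) :=
    ((isOpen_interior.mul_right).isClosed_compl.isCompact.image (by fun_prop)).isClosed
  have hu : u ∉ (fun g : G => g • u) '' (interior U * (stabilizer G u : Set G))ᶜ := by
    rintro ⟨g, hg, hgu⟩
    exact hg ⟨1, mem_interior_iff_mem_nhds.2 hU, g, hgu, one_mul g⟩
  filter_upwards [hcl.isOpen_compl.mem_nhds hu]
  rintro _ hv ⟨g, rfl⟩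
  by_cases hg : g ∈ interior U * (stabilizer G u : Set G)
  · obtain ⟨a, ha, h, hh, rfl⟩ := hg
    exact ⟨a, interior_subset ha, by simp only [mul_smul, mem_stabilizer_iff.1 hh]⟩
  · exact (hv ⟨g, hg, rfl⟩).elim

end Slice

/-! ### Nearest points on an orbit. -/

section Retraction

variable {G : Type*} [Group G] [TopologicalSpace G] [CompactSpace G]
  {N : Type*} [TopologicalSpace N] [MulAction G N] [ContinuousSMul G N] [CompactSpace N]
  {W : Type*} [NormedAddCommGroup W]

/-- Distances to an orbit, measured by the largest distance of translates under an embedding `e`,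
are attained at a unique point near `u` if squared distances are strictly convex along a
parametrization `ψ` of the orbit near `u`; such a point has larger isotropy. -/
theorem eventually_orbitTypeLE_of_parametrization {F : Type*} [NormedAddCommGroup F]
    [NormedSpace ℝ F] {e : N → W} (he : Continuous e) (hinj : Function.Injective e) {u : N}
    {ψ : F → N} {x₀ : F} {S : Submodule ℝ F} (hψ : ∀ x, ψ x ∈ orbit G u)
    (hcover : ∀ U ∈ 𝓝 x₀, ∀ᶠ v in 𝓝 u, v ∈ orbit G u → ∃ z ∈ U, z - x₀ ∈ S ∧ ψ z = v)
    (hconv : ∀ᶠ q : N × F × F in 𝓝 (u, x₀, x₀), ∀ g : G, q.2.1 - q.2.2 ∈ S → q.2.1 ≠ q.2.2 →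
      ‖e (g • q.1) - e (g • ψ (midpoint ℝ q.2.1 q.2.2))‖ ^ 2 <
        (‖e (g • q.1) - e (g • ψ q.2.1)‖ ^ 2 + ‖e (g • q.1) - e (g • ψ q.2.2)‖ ^ 2) / 2) :
    ∀ᶠ v in 𝓝 u, OrbitTypeLE G u v := by
  -- The supremum norm over `G` makes the distance invariant under the action without averaging the
  -- embedding.
  let Φ : N → C(G, W) := fun x => ⟨fun g => e (g • x), by fun_prop⟩
  have hΦc : Continuous Φ := ContinuousMap.continuous_of_continuous_uncurry _
    (by simp only [Φ, Function.uncurry_def, ContinuousMap.coe_mk]; fun_prop)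
  have hΦi : Function.Injective Φ := fun x y h => by
    have := DFunLike.congr_fun h (1 : G)
    exact hinj (by simpa [Φ] using this)
  have hΦs : ∀ (k : G) (x y : N), ‖Φ (k • x) - Φ (k • y)‖ ≤ ‖Φ x - Φ y‖ := by
    intro k x y
    refine (ContinuousMap.norm_le _ (norm_nonneg _)).2 fun g => ?_
    have := (Φ x - Φ y).norm_coe_le_norm (g * k)
    simpa [Φ, mul_smul] using this
  have hΦe := (hΦc.isClosedEmbedding hΦi).isInducing
  obtain ⟨V, hV, U, hU, hVU⟩ : ∃ V ∈ 𝓝 u, ∃ U ∈ 𝓝 x₀, ∀ p ∈ V, ∀ z ∈ U, ∀ z' ∈ U, ∀ g : G,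
      z - z' ∈ S → z ≠ z' → ‖e (g • p) - e (g • ψ (midpoint ℝ z z'))‖ ^ 2 <
        (‖e (g • p) - e (g • ψ z)‖ ^ 2 + ‖e (g • p) - e (g • ψ z')‖ ^ 2) / 2 := by
    rw [nhds_prod_eq, nhds_prod_eq] at hconv
    obtain ⟨V, hV, B, hB, h⟩ := eventually_prod_iff.1 hconv
    obtain ⟨U, hU, hUB⟩ := mem_prod_same_iff.1 hB
    exact ⟨{p | V p}, hV, U, hU, fun p hp z hz z' hz' g =>
      h hp (@hUB (z, z') ⟨hz, hz'⟩) g⟩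
  have hnear := hcover U hU
  obtain ⟨η, hη, hball⟩ := (Metric.nhds_basis_ball.comap Φ).eventually_iff.1
    (by rwa [← hΦe.nhds_eq_comap] : ∀ᶠ v in comap Φ (𝓝 (Φ u)), _)
  have hclose : ∀ᶠ p in 𝓝 u, ‖Φ p - Φ u‖ < η / 2 := by
    have := (hΦc.tendsto u).eventually (Metric.ball_mem_nhds _ (half_pos hη))
    simpa [dist_eq_norm] using this
  have hcpt : IsCompact (orbit G u) := isCompact_range (by fun_prop)
  filter_upwards [hV, hclose] with p hp hpu
  obtain ⟨x, hx, hmin⟩ := hcpt.exists_isMinOn ⟨u, mem_orbit_self u⟩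
    (f := fun x => ‖Φ p - Φ x‖) (by fun_prop)
  have hunique : ∀ y ∈ orbit G u, ‖Φ p - Φ y‖ ≤ ‖Φ p - Φ x‖ → y = x := by
    have hpar : ∀ y ∈ orbit G u, ‖Φ p - Φ y‖ ≤ ‖Φ p - Φ x‖ → ∃ z ∈ U, z - x₀ ∈ S ∧ ψ z = y := by
      intro y hy hyx
      refine hball ?_ hy
      have h1 : ‖Φ p - Φ x‖ ≤ ‖Φ p - Φ u‖ := hmin (mem_orbit_self u)
      have h2 := norm_sub_le_norm_sub_add_norm_sub (Φ y) (Φ p) (Φ u)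
      rw [norm_sub_rev (Φ y) (Φ p)] at h2
      simp only [mem_preimage, Metric.mem_ball, dist_eq_norm]
      linarith
    intro y hy hyx
    obtain ⟨z, hz, hzS, rfl⟩ := hpar y hy hyx
    obtain ⟨z', hz', hzS', hzx⟩ := hpar x hx le_rfl
    rw [← hzx] at hyx hmin ⊢
    by_contra hne
    have hzz : z ≠ z' := fun h => hne (by rw [h])
    have hS : z - z' ∈ S := by simpa using S.sub_mem hzS hzS'
    have hm : ‖Φ p - Φ (ψ z')‖ ≤ ‖Φ p - Φ (ψ (midpoint ℝ z z'))‖ := hmin (hψ _)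
    -- The midpoint would be strictly closer than the minimum: strictness at each `g` passes to the
    -- supremum because `G` is compact.
    refine hm.not_gt ((ContinuousMap.norm_lt_iff_of_nonempty _).2 fun g => ?_)
    have h1 := hVU p hp z hz z' hz' g hS hzz
    have h2 := (Φ p - Φ (ψ z)).norm_coe_le_norm g
    have h3 := (Φ p - Φ (ψ z')).norm_coe_le_norm g
    simp only [Φ, ContinuousMap.sub_apply, ContinuousMap.coe_mk] at h2 h3 ⊢
    refine lt_of_pow_lt_pow_left₀ 2 (norm_nonneg _) (h1.trans_le ?_)
    have h4 := pow_le_pow_left₀ (norm_nonneg _) (h2.trans hyx) 2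
    have h5 := pow_le_pow_left₀ (norm_nonneg _) h3 2
    simp only [Φ] at h4 h5 ⊢
    linarith
  have hle : stabilizer G p ≤ stabilizer G x := by
    intro k hk
    refine hunique (k • x) (mem_orbit_of_mem_orbit k hx) ?_
    have := hΦs k p x
    rwa [mem_stabilizer_iff.1 hk] at this
  obtain ⟨a, rfl⟩ := hx
  exact (orbitTypeLE_smul_right a (orbitTypeLE_of_stabilizer_le le_rfl)).trans
    (orbitTypeLE_of_stabilizer_le hle)

end Retraction

/-! ### Derivatives of translated embeddings. -/

section Manifold

variable {F : Type*} [NormedAddCommGroup F] [NormedSpace ℝ F]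
  {E : Type*} [NormedAddCommGroup E] [NormedSpace ℝ E]
  {N : Type*} [TopologicalSpace N] [ChartedSpace E N]
  {W : Type*} [NormedAddCommGroup W] [NormedSpace ℝ W]

/-- An immersion does not change the kernel. This lets `e` and its translates `e (g • ·)` be
interchanged in statements about the orbit map. -/
theorem fderiv_comp_apply_eq_zero_iff {h : N → W} {ψ : F → N} {x : F}
    (hh : MDifferentiableAt 𝓘(ℝ, E) 𝓘(ℝ, W) h (ψ x))
    (hinj : Function.Injective (mfderiv 𝓘(ℝ, E) 𝓘(ℝ, W) h (ψ x)))
    (hψ : MDifferentiableAt 𝓘(ℝ, F) 𝓘(ℝ, E) ψ x) (s : F) :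
    fderiv ℝ (fun y => h (ψ y)) x s = 0 ↔ mfderiv 𝓘(ℝ, F) 𝓘(ℝ, E) ψ x s = 0 := by
  have hcomp := mfderiv_comp x hh hψ
  rw [mfderiv_eq_fderiv] at hcomp
  have hval : fderiv ℝ (fun y => h (ψ y)) x s =
      mfderiv 𝓘(ℝ, E) 𝓘(ℝ, W) h (ψ x) (mfderiv 𝓘(ℝ, F) 𝓘(ℝ, E) ψ x s) :=
    DFunLike.congr_fun hcomp s
  rw [hval]
  exact map_eq_zero_iff _ hinj

theorem injective_mfderiv_comp_smul {G : Type*} [Group G] [MulAction G N]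
    (hsmul : ∀ g : G, ContMDiff 𝓘(ℝ, E) 𝓘(ℝ, E) ∞ fun x : N => g • x) {e : N → W}
    (he : ContMDiff 𝓘(ℝ, E) 𝓘(ℝ, W) ∞ e)
    (hinj : ∀ x, Function.Injective (mfderiv 𝓘(ℝ, E) 𝓘(ℝ, W) e x)) (g : G) (x : N) :
    Function.Injective (mfderiv 𝓘(ℝ, E) 𝓘(ℝ, W) (fun y => e (g • y)) x) := by
  have hd : ∀ (g : G) (y : N), MDifferentiableAt 𝓘(ℝ, E) 𝓘(ℝ, E) (fun x : N => g • x) y :=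
    fun g y => (hsmul g).mdifferentiable (by simp) y
  have h1 : mfderiv 𝓘(ℝ, E) 𝓘(ℝ, W) (fun y => e (g • y)) x =
      (mfderiv 𝓘(ℝ, E) 𝓘(ℝ, W) e (g • x)).comp
        (mfderiv 𝓘(ℝ, E) 𝓘(ℝ, E) (fun x : N => g • x) x) :=
    mfderiv_comp x (he.mdifferentiable (by simp) _) (hd g x)
  have h2 : (mfderiv 𝓘(ℝ, E) 𝓘(ℝ, E) (fun x : N => g⁻¹ • x) (g • x)).comp
      (mfderiv 𝓘(ℝ, E) 𝓘(ℝ, E) (fun x : N => g • x) x) =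
        ContinuousLinearMap.id ℝ (TangentSpace 𝓘(ℝ, E) x) := by
    have h3 := ((hd g⁻¹ (g • x)).hasMFDerivAt.comp x (hd g x).hasMFDerivAt)
    refine hasMFDerivAt_unique h3 ((hasMFDerivAt_id x).congr_of_eventuallyEq ?_)
    exact Eventually.of_forall fun y => inv_smul_smul g y
  rw [h1]
  refine (hinj _).comp (Function.LeftInverse.injective
    (g := mfderiv 𝓘(ℝ, E) 𝓘(ℝ, E) (fun x : N => g⁻¹ • x) (g • x)) fun v => ?_)
  exact DFunLike.congr_fun h2 v

end Manifold

/-! ### Semicontinuity of orbit types. -/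

section OrbitType

variable {F : Type*} [NormedAddCommGroup F] [NormedSpace ℝ F]
  {G : Type*} [Group G] [TopologicalSpace G] [ChartedSpace F G] [LieGroup 𝓘(ℝ, F) ∞ G]
  {E : Type*} [NormedAddCommGroup E] [NormedSpace ℝ E]
  {N : Type*} [TopologicalSpace N] [ChartedSpace E N]
  [MulAction G N]

variable (F) in
/-- The orbit map of `u`, read in the preferred chart of the group at `g₀`. -/
noncomputable def orbitChart (g₀ : G) (u : N) (x : F) : N :=
  (extChartAt 𝓘(ℝ, F) g₀).symm x • u

theorem contMDiffAt_extChartAt_symm (g₀ : G) {x : F} (hx : x ∈ (extChartAt 𝓘(ℝ, F) g₀).target) :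
    ContMDiffAt 𝓘(ℝ, F) 𝓘(ℝ, F) ∞ (extChartAt 𝓘(ℝ, F) g₀).symm x :=
  (contMDiffOn_extChartAt_symm g₀).contMDiffAt (extChartAt_target_mem_nhds' hx)

variable (E) in
theorem contMDiffAt_orbitChart [ContMDiffSMul 𝓘(ℝ, F) 𝓘(ℝ, E) ∞ G N] (g₀ : G) (u : N) {x : F}
    (hx : x ∈ (extChartAt 𝓘(ℝ, F) g₀).target) :
    ContMDiffAt 𝓘(ℝ, F) 𝓘(ℝ, E) ∞ (orbitChart F g₀ u) x :=
  (contMDiffAt_extChartAt_symm g₀ hx).smul contMDiffAt_const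

variable [FiniteDimensional ℝ F] {W : Type*} [NormedAddCommGroup W]

section Normed

variable [NormedSpace ℝ W] {e : N → W}

/-- The orbit map has constant rank near the identity. -/
theorem eventually_finrank_range_fderiv_le [ContMDiffSMul 𝓘(ℝ, F) 𝓘(ℝ, E) ∞ G N]
    [FiniteDimensional ℝ W]
    (he : ContMDiff 𝓘(ℝ, E) 𝓘(ℝ, W) ∞ e)
    (hinj : ∀ x, Function.Injective (mfderiv 𝓘(ℝ, E) 𝓘(ℝ, W) e x)) (u : N) :
    ∀ᶠ x in 𝓝 (extChartAt 𝓘(ℝ, F) (1 : G) 1), Module.finrank ℝ (LinearMap.range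
      (fderiv ℝ (fun x => e (orbitChart F (1 : G) u x)) x : F →ₗ[ℝ] W)) ≤
      Module.finrank ℝ (LinearMap.range (fderiv ℝ (fun x => e (orbitChart F (1 : G) u x))
        (extChartAt 𝓘(ℝ, F) (1 : G) 1) : F →ₗ[ℝ] W)) := by
  set c := extChartAt 𝓘(ℝ, F) (1 : G) with hc
  set ψ := orbitChart F (1 : G) u with hψ
  have hsmul : ∀ g : G, ContMDiff 𝓘(ℝ, E) 𝓘(ℝ, E) ∞ fun x : N => g • x :=
    fun g => ContMDiffSMul.contMDiff_const_smul (I := 𝓘(ℝ, F)) g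
  filter_upwards [extChartAt_target_mem_nhds (I := 𝓘(ℝ, F)) (1 : G)] with y hy
  set g := c.symm y with hg
  -- By homogeneity, `ψ = g • ψ ∘ α` near `y`, with `α y` the base point; so the rank at `y` is at
  -- most that of the translate of `ψ` at the base point.
  let α : F → F := fun z => c (g⁻¹ * c.symm z)
  have hmul : ContMDiffAt 𝓘(ℝ, F) 𝓘(ℝ, F) ∞ (fun z => g⁻¹ * c.symm z) y :=
    contMDiffAt_const.mul (contMDiffAt_extChartAt_symm (1 : G) hy)
  have hone : g⁻¹ * c.symm y = 1 := by rw [hg, inv_mul_cancel]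
  have hα : DifferentiableAt ℝ α y := by
    have h1 : ContMDiffAt 𝓘(ℝ, F) 𝓘(ℝ, F) ∞ α y := by
      refine ContMDiffAt.comp y (g := c) ?_ hmul
      rw [hone]
      exact contMDiffAt_extChartAt
    exact (contMDiffAt_iff_contDiffAt.1 h1).differentiableAt (by simp)
  have hαy : α y = c 1 := by simp only [α, hone]
  have hsrc : ∀ᶠ z in 𝓝 y, g⁻¹ * c.symm z ∈ c.source := by
    refine hmul.continuousAt.eventually ?_
    simp only [hone]
    exact extChartAt_source_mem_nhds _
  have heq : (fun z => e (ψ z)) =ᶠ[𝓝 y] (fun z => e (g • ψ z)) ∘ α := by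
    filter_upwards [hsrc] with z hz
    simp only [ψ, orbitChart, α, Function.comp, ← hc, c.left_inv hz, smul_smul,
      mul_inv_cancel_left]
  have hx0 : c 1 ∈ c.target := mem_extChartAt_target (1 : G)
  have hψd : MDifferentiableAt 𝓘(ℝ, F) 𝓘(ℝ, E) ψ (c 1) :=
    (contMDiffAt_orbitChart E (1 : G) u hx0).mdifferentiableAt (by simp)
  have hec : ContMDiff 𝓘(ℝ, E) 𝓘(ℝ, W) ∞ fun x => e (g • x) :=
    he.comp (hsmul g)
  have hed : DifferentiableAt ℝ (fun z => e (g • ψ z)) (α y) := by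
    rw [hαy]
    have := hec.contMDiffAt.comp (c 1) (contMDiffAt_orbitChart E (1 : G) u hx0)
    exact (contMDiffAt_iff_contDiffAt.1 this).differentiableAt (by simp)
  rw [heq.fderiv_eq, fderiv_comp y hed hα, hαy]
  have hker : LinearMap.ker (fderiv ℝ (fun z => e (g • ψ z)) (c 1) : F →ₗ[ℝ] W) =
      LinearMap.ker (fderiv ℝ (fun z => e (ψ z)) (c 1) : F →ₗ[ℝ] W) := by
    ext s
    exact (fderiv_comp_apply_eq_zero_iff (hec.mdifferentiable (by simp) _)
      (injective_mfderiv_comp_smul hsmul he hinj g _) hψd s).trans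
      (fderiv_comp_apply_eq_zero_iff (he.mdifferentiable (by simp) _) (hinj _) hψd s).symm
  have h1 := LinearMap.finrank_range_add_finrank_ker
    (fderiv ℝ (fun z => e (g • ψ z)) (c 1) : F →ₗ[ℝ] W)
  have h2 := LinearMap.finrank_range_add_finrank_ker
    (fderiv ℝ (fun z => e (ψ z)) (c 1) : F →ₗ[ℝ] W)
  rw [hker] at h1
  refine (Submodule.finrank_mono (LinearMap.range_comp_le_range _ _)).trans
    (le_of_eq (Nat.add_right_cancel (h1.trans h2.symm)))

end Normed

/-- For uniformity in `g`, the group element becomes an extra variable of `Θ`, read in a chart at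
`g₀`. Differences in `⊥.prod S` leave it fixed, so the convexity lemma covers all `g` near `g₀`, and
compactness of `G` covers the rest. -/
theorem eventually_translates_midpoint_lt [ContMDiffSMul 𝓘(ℝ, F) 𝓘(ℝ, E) ∞ G N]
    [CompactSpace G]
    [InnerProductSpace ℝ W] {e : N → W}
    (he : ContMDiff 𝓘(ℝ, E) 𝓘(ℝ, W) ∞ e)
    (hinj : ∀ x, Function.Injective (mfderiv 𝓘(ℝ, E) 𝓘(ℝ, W) e x)) (u : N)
    {S : Submodule ℝ F} (hS : ∀ s ∈ S, fderiv ℝ (fun x => e (orbitChart F (1 : G) u x))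
      (extChartAt 𝓘(ℝ, F) (1 : G) 1) s = 0 → s = 0) :
    ∀ᶠ q : N × F × F in 𝓝 (u, extChartAt 𝓘(ℝ, F) (1 : G) 1, extChartAt 𝓘(ℝ, F) (1 : G) 1),
      ∀ g : G, q.2.1 - q.2.2 ∈ S → q.2.1 ≠ q.2.2 →
        ‖e (g • q.1) - e (g • orbitChart F (1 : G) u (midpoint ℝ q.2.1 q.2.2))‖ ^ 2 <
          (‖e (g • q.1) - e (g • orbitChart F (1 : G) u q.2.1)‖ ^ 2 +
            ‖e (g • q.1) - e (g • orbitChart F (1 : G) u q.2.2)‖ ^ 2) / 2 := by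
  have := ContMDiffSMul.continuousSMul (G := G) (M := N) (I := 𝓘(ℝ, F)) (I' := 𝓘(ℝ, E)) ∞
  set x₀ := extChartAt 𝓘(ℝ, F) (1 : G) 1 with hx₀def
  set ψ := orbitChart F (1 : G) u with hψ
  have hx0 : x₀ ∈ (extChartAt 𝓘(ℝ, F) (1 : G)).target := mem_extChartAt_target (1 : G)
  have hψc : ContMDiffAt 𝓘(ℝ, F) 𝓘(ℝ, E) ∞ ψ x₀ := contMDiffAt_orbitChart E (1 : G) u hx0
  have hψd : MDifferentiableAt 𝓘(ℝ, F) 𝓘(ℝ, E) ψ x₀ := hψc.mdifferentiableAt (by simp)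
  have hψ0 : ψ x₀ = u := by
    simp only [ψ, orbitChart, x₀, extChartAt_to_inv, one_smul]
  have hsmul : ∀ g : G, ContMDiff 𝓘(ℝ, E) 𝓘(ℝ, E) ∞ fun x : N => g • x :=
    fun g => ContMDiffSMul.contMDiff_const_smul (I := 𝓘(ℝ, F)) g
  suffices h : ∀ g₀ : G, ∀ᶠ r : (N × F × F) × G in 𝓝 ((u, x₀, x₀), g₀),
      r.1.2.1 - r.1.2.2 ∈ S → r.1.2.1 ≠ r.1.2.2 →
        ‖e (r.2 • r.1.1) - e (r.2 • ψ (midpoint ℝ r.1.2.1 r.1.2.2))‖ ^ 2 <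
          (‖e (r.2 • r.1.1) - e (r.2 • ψ r.1.2.1)‖ ^ 2 +
            ‖e (r.2 • r.1.1) - e (r.2 • ψ r.1.2.2)‖ ^ 2) / 2 by
    refine (isCompact_univ.eventually_forall_of_forall_eventually
      (fun g _ => (h g))).mono fun q hq g => hq g (mem_univ g)
  intro g₀
  set c := extChartAt 𝓘(ℝ, F) g₀ with hc
  have hcg : c.symm (c g₀) = g₀ := extChartAt_to_inv g₀
  let Θ : F × F → W := fun z => e (c.symm z.1 • ψ z.2)
  have hΘ : ContDiffAt ℝ ∞ Θ (c g₀, x₀) := by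
    rw [← contMDiffAt_iff_contDiffAt]
    refine he.contMDiffAt.comp _ (ContMDiffAt.smul (I := 𝓘(ℝ, F)) ?_ ?_)
    · exact ContMDiffAt.comp (c g₀, x₀)
        (contMDiffAt_extChartAt_symm g₀ (mem_extChartAt_target g₀))
        (contDiff_fst.contMDiff.contMDiffAt)
    · exact ContMDiffAt.comp (c g₀, x₀) (g := ψ) hψc (contDiff_snd.contMDiff.contMDiffAt)
  have hS' : ∀ s ∈ (⊥ : Submodule ℝ F).prod S, fderiv ℝ Θ (c g₀, x₀) s = 0 → s = 0 := by
    rintro ⟨a, s⟩ ⟨ha, hs⟩ h0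
    obtain rfl : a = 0 := by simpa using ha
    have hd : HasFDerivAt (fun y : F => (c g₀, y)) (ContinuousLinearMap.inr ℝ F F) x₀ :=
      hasFDerivAt_prodMk_right _ _
    have h1 := ((hΘ.differentiableAt (by simp)).hasFDerivAt.comp x₀ hd).fderiv
    have h2 : fderiv ℝ (fun y => e (g₀ • ψ y)) x₀ s = 0 := by
      have h3 : (Θ ∘ fun y : F => (c g₀, y)) = fun y => e (g₀ • ψ y) := by
        funext y
        simp only [Θ, Function.comp, hcg]
      rw [h3] at h1
      rw [h1]
      exact h0
    have h4 := (fderiv_comp_apply_eq_zero_iff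
      ((he.comp (hsmul g₀)).mdifferentiable (by simp) _)
      (injective_mfderiv_comp_smul hsmul he hinj g₀ _) hψd s).1 h2
    rw [hS s hs ((fderiv_comp_apply_eq_zero_iff (he.mdifferentiable (by simp) _) (hinj _)
      hψd s).2 h4)]
    rfl
  have hmid := eventually_norm_sub_midpoint_sq_lt (hΘ.of_le (by norm_cast)) hS'
  have hcc : ContinuousAt c g₀ := continuousAt_extChartAt g₀
  have htend : Tendsto (fun r : (N × F × F) × G =>
      (e (r.2 • r.1.1), (c r.2, r.1.2.1), (c r.2, r.1.2.2))) (𝓝 ((u, x₀, x₀), g₀))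
      (𝓝 (Θ (c g₀, x₀), (c g₀, x₀), (c g₀, x₀))) := by
    have hec : Continuous e := he.continuous
    have hc2 : ContinuousAt (fun r : (N × F × F) × G => c r.2) ((u, x₀, x₀), g₀) :=
      ContinuousAt.comp (g := c) hcc continuousAt_snd
    have h1 : ContinuousAt (fun r : (N × F × F) × G =>
      (e (r.2 • r.1.1), (c r.2, r.1.2.1), (c r.2, r.1.2.2))) ((u, x₀, x₀), g₀) := by
      refine ContinuousAt.prodMk (by fun_prop) (ContinuousAt.prodMk ?_ ?_)
      · exact hc2.prodMk (by fun_prop)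
      · exact hc2.prodMk (by fun_prop)
    have h2 : Θ (c g₀, x₀) = e (g₀ • u) := by simp only [Θ, hcg, hψ0]
    rw [h2]
    exact h1
  have hsrc : ∀ᶠ r : (N × F × F) × G in 𝓝 ((u, x₀, x₀), g₀), r.2 ∈ c.source :=
    (continuous_snd.tendsto ((u, x₀, x₀), g₀)).eventually (extChartAt_source_mem_nhds g₀)
  filter_upwards [htend.eventually hmid, hsrc]
  rintro ⟨⟨p, y₁, y₂⟩, g⟩ h hg hy hne
  have hm : midpoint ℝ (c g, y₁) (c g, y₂) = (c g, midpoint ℝ y₁ y₂) := by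
    ext <;> simp [midpoint_eq_smul_add, ← two_smul ℝ (c g), smul_smul]
  have h' := h ⟨by simp, hy⟩ (fun h => hne (congrArg Prod.snd h))
  simpa only [hm, Θ, c.left_inv hg] using h'

/-- Isotropy groups near `u` are subconjugate to the isotropy group of `u`. -/
theorem eventually_orbitTypeLE [ContMDiffSMul 𝓘(ℝ, F) 𝓘(ℝ, E) ∞ G N]
    [FiniteDimensional ℝ E] [IsManifold 𝓘(ℝ, E) ∞ N]
    [CompactSpace G] [T2Space N] [CompactSpace N] (u : N) :
    ∀ᶠ v in 𝓝 u, OrbitTypeLE G u v := by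
  have := ContMDiffSMul.continuousSMul (G := G) (M := N) (I := 𝓘(ℝ, F)) (I' := 𝓘(ℝ, E)) ∞
  have := topologicalGroup_of_lieGroup 𝓘(ℝ, F) ∞ (G := G)
  obtain ⟨n, e, he, hemb, hinj⟩ := exists_embedding_euclidean_of_compact (I := 𝓘(ℝ, E)) (M := N)
  have hx0 : extChartAt 𝓘(ℝ, F) (1 : G) 1 ∈ (extChartAt 𝓘(ℝ, F) (1 : G)).target :=
    mem_extChartAt_target (1 : G)
  have hsmooth : ContDiffAt ℝ 1 (fun x => e (orbitChart F (1 : G) u x))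
      (extChartAt 𝓘(ℝ, F) (1 : G) 1) :=
    ((contMDiffAt_iff_contDiffAt.1
      (he.contMDiffAt.comp _ (contMDiffAt_orbitChart E (1 : G) u hx0))).of_le (by simp))
  obtain ⟨S, hS, hcover⟩ := exists_transversal_of_finrank_range_le hsmooth
    (eventually_finrank_range_fderiv_le he hinj u)
  refine eventually_orbitTypeLE_of_parametrization he.continuous hemb.injective
    (ψ := orbitChart F (1 : G) u) (S := S) (fun x => mem_orbit _ _) (fun U hU => ?_)
    (eventually_translates_midpoint_lt he hinj u hS)
  -- The transversal covers values at group elements near `1`; openness of the orbit map turns this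
  -- into covering the orbit points near `u`.
  have hpre : ∀ᶠ g in 𝓝 (1 : G), g ∈ (extChartAt 𝓘(ℝ, F) (1 : G)).source ∧
      ∃ z ∈ U, z - extChartAt 𝓘(ℝ, F) (1 : G) 1 ∈ S ∧ e (orbitChart F (1 : G) u z) =
        e (orbitChart F (1 : G) u (extChartAt 𝓘(ℝ, F) (1 : G) g)) :=
    (show ∀ᶠ g in 𝓝 (1 : G), g ∈ (extChartAt 𝓘(ℝ, F) (1 : G)).source from
      extChartAt_source_mem_nhds _).and
      ((continuousAt_extChartAt (I := 𝓘(ℝ, F)) (1 : G)).eventually (hcover U hU))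
  filter_upwards [eventually_exists_smul_eq hpre] with v hv hvu
  obtain ⟨g, ⟨hg, z, hzU, hzS, hz⟩, rfl⟩ := hv hvu
  refine ⟨z, hzU, hzS, (hemb.injective hz).trans ?_⟩
  simp only [orbitChart, (extChartAt 𝓘(ℝ, F) (1 : G)).left_inv hg]

end OrbitType

end EquivariantLS

theorem mainTheorem7
    {F : Type*} [NormedAddCommGroup F] [NormedSpace ℝ F] [FiniteDimensional ℝ F]
    {G : Type*} [Group G] [TopologicalSpace G] [ChartedSpace F G] [LieGroup 𝓘(ℝ, F) ∞ G]
    [T2Space G] [CompactSpace G]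
    {E : Type*} [NormedAddCommGroup E] [NormedSpace ℝ E] [FiniteDimensional ℝ E]
    {N : Type*} [TopologicalSpace N] [ChartedSpace E N] [IsManifold 𝓘(ℝ, E) ∞ N]
    [T2Space N] [CompactSpace N]
    [MulAction G N] [ContMDiffSMul 𝓘(ℝ, F) 𝓘(ℝ, E) ∞ G N] :
    EquivariantLS.numLocallyMinimal G N ≤ EquivariantLS.gCat G N ∧
      ∀ u : N, EquivariantLS.IsLocallyMinimal G u ↔ IsClosed (EquivariantLS.stratum G u) := by
  have := ContMDiffSMul.continuousSMul (G := G) (M := N) (I := 𝓘(ℝ, F)) (I' := 𝓘(ℝ, E)) ∞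
  have := topologicalGroup_of_lieGroup 𝓘(ℝ, F) ∞ (G := G)
  exact ⟨EquivariantLS.numLocallyMinimal_le_gCat, fun u => ⟨fun h => h.isClosed,
    EquivariantLS.isLocallyMinimal_of_isClosed
      (EquivariantLS.eventually_orbitTypeLE (F := F) (E := E))⟩⟩
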